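/- Let $n\ge 1$, let $A=[a_{ij}]\in\mathbb{R}^{n\times n}$ have zero diagonal, and let $\kappa>0$. Let $\mathcal G(A)$ be the signed digraph on $\{1,\dots,n\}$ with an edge from $j$ to $i$ if and only if $a_{ij}\neq 0$, and let $L=D-A$ be its Laplacian, where $D=\mathrm{diag}(d_1,\dots,d_n)$ and $d_i=\sum_{j}|a_{ij}|$. For a vector $\zeta$ write $D_\zeta=\mathrm{diag}(\zeta)$. The matrix $A$ is called essentially nonnegative if there is a vector $\zeta\in\mathbb{C}^n$ with $|\zeta_i|=1$ for all $i$ such that $D_\zeta^{-1}AD_\zeta$ has nonnegative real entries. The digraph $\mathcal G(A)$ has a spanning tree if some vertex has a directed path to every other vertex. The system $$\dot x(t)=-\kappa Lx(t),\qquad t\ge 0,\quad x(t)\in\mathbb{R}^n,$$ achieves bipartite consensus if for every solution $x$ there is $a\ge 0$ such that each $x_i(t)$ converges to $a$ or to $-a$ as $t\to\infty$, and $a>0$ for at least one solution (equivalently, by linearity, for all initial states outside a proper linear subspace). Then the system achieves bipartite consensus if and only if $A$ is essentially nonnegative and $\mathcal G(A)$ has a spanning tree. In this case there is $\sigma\in\{\pm1\}^n$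 such that $D_\sigma AD_\sigma$ is a nonnegative matrix; for every such $\sigma$ there is $\eta\in\mathbb{R}^n$ with $\eta^TL=0$, $\|\eta\|_1=\sum_i|\eta_i|=1$ and $\eta=D_\sigma\nu$ for some entrywise nonnegative $\nu\in\mathbb{R}^n$; and for all such $\sigma,\eta$ and every initial state $x(0)\in\mathbb{R}^n$ the solution satisfies $$\lim_{t\to\infty}x(t)=(\eta^Tx(0))\,\sigma .$$ -/

import Mathlib

namespace SignedConsensus

/-- The digraph `G(A)` of a square matrix: there is an edge from `j` to `i` iff `A i j ≠ 0`. -/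
def graphOf {n : ℕ} (A : Matrix (Fin n) (Fin n) ℝ) : Digraph (Fin n) where
  Adj j i := A i j ≠ 0

/-- A digraph has a (directed) spanning tree if some vertex, a root, has a directed path to every
other vertex. -/
def HasSpanningTree {V : Type*} (G : Digraph V) : Prop :=
  ∃ r : V, ∀ v : V, v ≠ r → Relation.ReflTransGen G.Adj r v

/-- The Laplacian `L = D - A`, where `D` is diagonal with entries `d i = ∑ j, |A i j|`
(the non-neighbours of `i` contribute zero to this sum). -/
def laplacian {n : ℕ} (A : Matrix (Fin n) (Fin n) ℝ) : Matrix (Fin n) (Fin n) ℝ :=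
  Matrix.diagonal (fun i => ∑ j, |A i j|) - A

/-- The diagonal matrix `D_ζ` of a vector `ζ` of unit complex numbers. -/
noncomputable def diagCircle {n : ℕ} (ζ : Fin n → Circle) : Matrix (Fin n) (Fin n) ℂ :=
  Matrix.diagonal (fun i => (ζ i : ℂ))

/-- Switching equivalence: `A₂ = D_ζ⁻¹ A₁ D_ζ` for some vector `ζ` of unit complex numbers. -/
def SwitchingEquivalent {n : ℕ} (A₁ A₂ : Matrix (Fin n) (Fin n) ℂ) : Prop :=
  ∃ ζ : Fin n → Circle, A₂ = (diagCircle ζ)⁻¹ * A₁ * diagCircle ζ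

/-- A complex matrix is essentially nonnegative if it is switching equivalent to a matrix with
nonnegative real entries. -/
def EssentiallyNonnegative {n : ℕ} (A : Matrix (Fin n) (Fin n) ℂ) : Prop :=
  ∃ B : Matrix (Fin n) (Fin n) ℝ, (∀ i j, 0 ≤ B i j) ∧
    SwitchingEquivalent A (B.map Complex.ofReal)

/-- `x` solves `ẋ(t) = -κ L x(t)` for `t ≥ 0` (with the one-sided derivative at `t = 0`). -/
def IsSolution {n : ℕ} (κ : ℝ) (A : Matrix (Fin n) (Fin n) ℝ) (x : ℝ → Fin n → ℝ) : Prop :=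
  ∀ t : ℝ, 0 ≤ t →
    HasDerivWithinAt x (-(κ • (laplacian A).mulVec (x t))) (Set.Ici 0) t

/-- Along the trajectory `x`, every agent converges to `a` or to `-a`. -/
def ConvergesUpToSign {n : ℕ} (x : ℝ → Fin n → ℝ) (a : ℝ) : Prop :=
  ∀ i, Filter.Tendsto (fun t => x t i) Filter.atTop (nhds a) ∨
    Filter.Tendsto (fun t => x t i) Filter.atTop (nhds (-a))

/-- The system `ẋ = -κ L x` achieves bipartite consensus: along every solution all agents converge
to a common value up to sign, and this common modulus is not always zero. (It cannot be positive
for every initial state, as `x(0) = 0` shows; by linearity, once it is positive for one initial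
state it is positive for all initial states outside a proper linear subspace.) -/
def AchievesBipartiteConsensus {n : ℕ} (κ : ℝ) (A : Matrix (Fin n) (Fin n) ℝ) : Prop :=
  (∀ x, IsSolution κ A x → ∃ a : ℝ, 0 ≤ a ∧ ConvergesUpToSign x a) ∧
    ∃ x, IsSolution κ A x ∧ ∃ a : ℝ, 0 < a ∧ ConvergesUpToSign x a

/-- `σ ∈ {±1}ⁿ` and `D_σ A D_σ` is a nonnegative matrix. -/
def IsSignSwitching {n : ℕ} (A : Matrix (Fin n) (Fin n) ℝ) (σ : Fin n → ℝ) : Prop :=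
  (∀ i, σ i = 1 ∨ σ i = -1) ∧
    ∀ i j, 0 ≤ (Matrix.diagonal σ * A * Matrix.diagonal σ) i j

/-- `ηᵀ L = 0`, `‖η‖₁ = 1`, and `η = D_σ ν` with `ν` entrywise nonnegative. The last condition
selects, among the two vectors `η` and `-η`, the one that goes with `σ`. -/
def IsNormalizedLeftNull {n : ℕ} (A : Matrix (Fin n) (Fin n) ℝ) (σ η : Fin n → ℝ) : Prop :=
  Matrix.vecMul η (laplacian A) = 0 ∧ ∑ i, |η i| = 1 ∧
    ∃ ν : Fin n → ℝ, (∀ i, 0 ≤ ν i) ∧ η = (Matrix.diagonal σ).mulVec ν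

end SignedConsensus

/-!
Switching by `σ` conjugates the system to that of a nonnegative matrix, whose flow `exp (-κ t L)`
is a semigroup of Markov operators: up to a scalar factor it is the exponential of `-κ L + c`, a
nonnegative matrix. Along the paths of a spanning tree this exponential reaches every vertex from
the root `r`, so all vertices give positive weight to `r` at time one and, by Doeblin's argument,
every state converges to a constant. The weights of this constant form an invariant distribution
`ν`, and `η = D_σ ν`.

Conversely, the limit `a σ` of a trajectory with `a > 0` is an equilibrium. The `i`-th entry of
`L σ = 0` is the equality case of the triangle inequality for `∑ j, σ i * A i j * σ j`, hence
`σ i * A i j * σ j = |A i j|`. If there were no spanning tree, two vertices without a common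
ancestor could be driven independently to limits of different moduli.
-/

namespace SignedConsensus

open Filter Topology Matrix NormedSpace Function

section LinearFlow

variable {E F : Type*} [NormedAddCommGroup E] [NormedSpace ℝ E]
  [NormedAddCommGroup F] [NormedSpace ℝ F]

/-- The flow `exp (t T)` of the linear differential equation `ẋ = T x`. -/
noncomputable def linearFlow (T : E →L[ℝ] E) (t : ℝ) : E →L[ℝ] E :=
  exp (t • T)

theorem linearFlow_zero_right (T : E →L[ℝ] E) : linearFlow T 0 = 1 := by
  rw [linearFlow, zero_smul, exp_zero]

theorem linearFlow_zero_left (t : ℝ) : linearFlow (0 : E →L[ℝ] E) t = 1 := by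
  rw [linearFlow, smul_zero, exp_zero]

variable [CompleteSpace E] {T : E →L[ℝ] E}

theorem hasSum_exp_apply (T : E →L[ℝ] E) (x : E) :
    HasSum (fun k : ℕ => (k.factorial : ℝ)⁻¹ • T^[k] x) (exp T x) := by
  simpa [FunLike.coe_pow_eq_iterate] using
    (exp_series_hasSum_exp' (𝕂 := ℝ) T).mapL (ContinuousLinearMap.apply ℝ E x)

theorem linearFlow_add_apply (T : E →L[ℝ] E) (s t : ℝ) (x : E) :
    linearFlow T (s + t) x = linearFlow T s (linearFlow T t x) := by
  let := NormedAlgebra.restrictScalars ℚ ℝ (E →L[ℝ] E)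
  rw [linearFlow, add_smul,
    NormedSpace.exp_add_of_commute (((Commute.refl T).smul_left s).smul_right t)]
  rfl

theorem linearFlow_sub_smul_one (T : E →L[ℝ] E) (c t : ℝ) :
    linearFlow (T - c • 1) t = Real.exp (-(t * c)) • linearFlow T t := by
  let := NormedAlgebra.restrictScalars ℚ ℝ (E →L[ℝ] E)
  have hsplit : t • (T - c • 1) = algebraMap ℝ (E →L[ℝ] E) (-(t * c)) + t • T := by
    rw [Algebra.algebraMap_eq_smul_one]
    module
  rw [linearFlow, hsplit, NormedSpace.exp_add_of_commute (Algebra.commutes _ _),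
    ← algebraMap_exp_comm, ← Real.exp_eq_exp_ℝ, ← Algebra.smul_def, linearFlow]

theorem hasDerivAt_linearFlow_apply (T : E →L[ℝ] E) (x : E) (t : ℝ) :
    HasDerivAt (fun s => linearFlow T s x) (T (linearFlow T t x)) t := by
  simpa [linearFlow] using
    (hasDerivAt_exp_smul_const' (𝕂 := ℝ) T t).clm_apply (hasDerivAt_const t x)

theorem eq_linearFlow_of_hasDerivWithinAt {x : ℝ → E}
    (hx : ∀ t, 0 ≤ t → HasDerivWithinAt x (T (x t)) (Set.Ici 0) t) {t : ℝ} (ht : 0 ≤ t) :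
    x t = linearFlow T t (x 0) := by
  have hflow (s : ℝ) := hasDerivAt_linearFlow_apply T (x 0) s
  refine ODE_solution_unique (v := fun _ => T) (fun _ => T.lipschitz)
    (fun s hs => (hx s hs.1).continuousWithinAt.mono Set.Icc_subset_Ici_self)
    (fun s hs => (hx s hs.1).mono (Set.Ici_subset_Ici.2 hs.1))
    (fun s _ => (hflow s).continuousAt.continuousWithinAt)
    (fun s _ => (hflow s).hasDerivWithinAt) ?_ (Set.right_mem_Icc.2 ht)
  rw [linearFlow_zero_right, one_apply_eq_self]

theorem semiconj_linearFlow [CompleteSpace F] {T' : F →L[ℝ] F} {S : E →L[ℝ] F}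
    (h : Semiconj S T T') (t : ℝ) : Semiconj S (linearFlow T t) (linearFlow T' t) := by
  have hsmul : Semiconj S (t • T) (t • T') := fun x => by
    simp [h.eq]
  intro x
  have hiterate (k : ℕ) : S ((t • T)^[k] x) = (t • T')^[k] (S x) := hsmul.iterate_right k x
  refine ((hasSum_exp_apply (t • T) x).mapL S).unique ?_
  simpa only [map_smul, hiterate, linearFlow] using hasSum_exp_apply (t • T') (S x)

theorem linearFlow_apply_map (T : E →L[ℝ] E) (t : ℝ) (x : E) :
    linearFlow T t (T x) = T (linearFlow T t x) :=
  (semiconj_linearFlow (S := T) (fun _ => rfl) t x).symm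

theorem linearFlow_apply_of_map_eq_zero {w : E} (hw : T w = 0) (t : ℝ) :
    linearFlow T t w = w := by
  have h : Semiconj (ContinuousLinearMap.toSpanSingleton ℝ w) (0 : ℝ →L[ℝ] ℝ) T := fun c => by
    simp [hw]
  simpa [linearFlow_zero_left] using (semiconj_linearFlow h t 1).symm

theorem map_linearFlow_apply_of_comp_eq_zero [CompleteSpace F] {S : E →L[ℝ] F}
    (hS : ∀ x, S (T x) = 0) (t : ℝ) (x : E) : S (linearFlow T t x) = S x := by
  have h : Semiconj S T (0 : F →L[ℝ] F) := hS
  simpa [linearFlow_zero_left] using semiconj_linearFlow h t x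

theorem linearFlow_apply_mem {W : Submodule ℝ E} (hclosed : IsClosed (W : Set E))
    (hW : ∀ w ∈ W, T w ∈ W) {w : E} (hw : w ∈ W) (t : ℝ) : linearFlow T t w ∈ W := by
  have := hclosed.completeSpace_coe
  have h : Semiconj W.subtypeL (T.restrict hW) T := fun _ => rfl
  have hrestrict : (linearFlow (T.restrict hW) t ⟨w, hw⟩ : E) = linearFlow T t w :=
    semiconj_linearFlow h t ⟨w, hw⟩
  exact hrestrict ▸ Subtype.coe_prop _

theorem map_eq_zero_of_tendsto_linearFlow {x w : E}
    (h : Tendsto (fun t => linearFlow T t x) atTop (𝓝 w)) : T w = 0 := by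
  have hfixed (s : ℝ) : linearFlow T s w = w := by
    refine tendsto_nhds_unique (((linearFlow T s).continuous.tendsto w).comp h) ?_
    refine (h.comp (tendsto_atTop_add_const_left atTop s tendsto_id)).congr fun t => ?_
    exact linearFlow_add_apply T s t x
  have hderiv := hasDerivAt_linearFlow_apply T w 0
  simp only [hfixed] at hderiv
  exact hderiv.unique (hasDerivAt_const 0 w)

end LinearFlow

section Positivity

variable {E : Type*} [NormedAddCommGroup E] [NormedSpace ℝ E] [CompleteSpace E] [PartialOrder E]
  [IsOrderedAddMonoid E] [PosSMulMono ℝ E] [OrderClosedTopology E] {P : E →L[ℝ] E} {x : E}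

theorem inv_factorial_smul_iterate_le_exp_apply (hP : Monotone P) (hx : 0 ≤ x) (k : ℕ) :
    (k.factorial : ℝ)⁻¹ • P^[k] x ≤ exp P x := by
  have hiterate (j : ℕ) : 0 ≤ P^[j] x := by
    simpa only [iterate_map_zero] using hP.iterate j hx
  exact le_hasSum (hasSum_exp_apply P x) k fun j _ => smul_nonneg (by positivity) (hiterate j)

theorem exp_apply_nonneg (hP : Monotone P) (hx : 0 ≤ x) : 0 ≤ exp P x :=
  hx.trans <| by simpa using inv_factorial_smul_iterate_le_exp_apply hP hx 0

theorem monotone_linearFlow_sub_smul_one (hP : Monotone P) (c : ℝ) {t : ℝ} (ht : 0 ≤ t) :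
    Monotone (linearFlow (P - c • 1) t) := by
  have hsmul : Monotone (t • P) := fun _ _ hxy => smul_le_smul_of_nonneg_left (hP hxy) ht
  refine (monotone_iff_map_nonneg _).2 fun x hx => ?_
  rw [linearFlow_sub_smul_one]
  exact smul_nonneg (Real.exp_nonneg _) (exp_apply_nonneg hsmul hx)

theorem exists_pos_smul_iterate_le_linearFlow_one (hP : Monotone P) (c : ℝ) (hx : 0 ≤ x) (k : ℕ) :
    ∃ ε : ℝ, 0 < ε ∧ ε • P^[k] x ≤ linearFlow (P - c • 1) 1 x := by
  refine ⟨Real.exp (-(1 * c)) * (k.factorial : ℝ)⁻¹, by positivity, ?_⟩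
  rw [linearFlow_sub_smul_one, linearFlow, one_smul, mul_smul]
  exact smul_le_smul_of_nonneg_left (inv_factorial_smul_iterate_le_exp_apply hP hx k)
    (Real.exp_nonneg _)

end Positivity

section Consensus

variable {ι : Type*}

/-- A Markov operator on `ι → ℝ`, i.e. a row-stochastic matrix seen as an operator: it preserves
the order and the constant vectors. -/
structure IsMarkov (P : (ι → ℝ) →L[ℝ] (ι → ℝ)) : Prop where
  monotone : Monotone P
  map_one : P 1 = 1

/-- The spread of the entries of a vector: the largest entry minus the smallest one. -/
noncomputable def spread (x : ι → ℝ) : ℝ :=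
  (⨆ i, x i) - ⨅ i, x i

theorem mem_Icc_iInf_iSup [Finite ι] (x : ι → ℝ) :
    x ∈ Set.Icc (const ι (⨅ i, x i)) (const ι (⨆ i, x i)) :=
  ⟨ciInf_le (Finite.bddBelow_range x), le_ciSup (Finite.bddAbove_range x)⟩

theorem spread_le_of_mem_Icc [Nonempty ι] {x : ι → ℝ} {m M : ℝ}
    (hx : x ∈ Set.Icc (const ι m) (const ι M)) : spread x ≤ M - m :=
  sub_le_sub (ciSup_le hx.2) (le_ciInf hx.1)

theorem abs_sub_le_spread [Finite ι] (x : ι → ℝ) (i j : ι) : |x i - x j| ≤ spread x :=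
  Real.dist_le_of_mem_Icc ⟨(mem_Icc_iInf_iSup x).1 i, (mem_Icc_iInf_iSup x).2 i⟩
    ⟨(mem_Icc_iInf_iSup x).1 j, (mem_Icc_iInf_iSup x).2 j⟩

theorem exists_eq_const_of_spread_nonpos [Finite ι] [Nonempty ι] {x : ι → ℝ} (hx : spread x ≤ 0) :
    ∃ a, x = const ι a := by
  obtain ⟨r⟩ := ‹Nonempty ι›
  exact ⟨x r, funext fun i => sub_eq_zero.1 <| abs_nonpos_iff.1 <|
    (abs_sub_le_spread x i r).trans hx⟩

section Markov

variable {P : (ι → ℝ) →L[ℝ] (ι → ℝ)}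

theorem IsMarkov.map_const (hP : IsMarkov P) (a : ℝ) : P (const ι a) = const ι a := by
  have h : const ι a = a • 1 := by ext; simp
  rw [h, map_smul, hP.map_one]

theorem IsMarkov.map_mem_Icc (hP : IsMarkov P) {x : ι → ℝ} {m M : ℝ}
    (hx : x ∈ Set.Icc (const ι m) (const ι M)) : P x ∈ Set.Icc (const ι m) (const ι M) :=
  ⟨hP.map_const m ▸ hP.monotone hx.1, hP.map_const M ▸ hP.monotone hx.2⟩

theorem IsMarkov.dist_map_self_le_spread [Fintype ι] [Nonempty ι] (hP : IsMarkov P) (x : ι → ℝ) :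
    dist (P x) x ≤ spread x := by
  have hx := mem_Icc_iInf_iSup x
  have hPx := hP.map_mem_Icc hx
  exact dist_pi_le_iff'.2 fun i =>
    Real.dist_le_of_mem_Icc ⟨hPx.1 i, hPx.2 i⟩ ⟨hx.1 i, hx.2 i⟩

variable [DecidableEq ι]

theorem IsMarkov.map_single_le_one (hP : IsMarkov P) (r i : ι) : P (Pi.single r 1) i ≤ 1 := by
  have hle : Pi.single r 1 ≤ (1 : ι → ℝ) := fun j => by
    rw [Pi.single_apply]
    split_ifs <;> simp
  have h := hP.monotone hle i
  rwa [hP.map_one] at h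

theorem IsMarkov.le_map_apply (hP : IsMarkov P) {r : ι} {δ m : ℝ}
    (hδ : ∀ i, δ ≤ P (Pi.single r 1) i) {x : ι → ℝ} (hx : const ι m ≤ x) (i : ι) :
    m + δ * (x r - m) ≤ P x i := by
  have hle : const ι m + (x r - m) • Pi.single r 1 ≤ x := fun j => by
    obtain rfl | hj := eq_or_ne j r
    · simp
    · simpa [hj] using hx j
  have hPx := hP.monotone hle i
  rw [map_add, map_smul, hP.map_const] at hPx
  have := mul_le_mul_of_nonneg_left (hδ i) (sub_nonneg.2 (hx r))
  simp only [Pi.add_apply, const_apply, Pi.smul_apply, smul_eq_mul] at hPx this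
  linarith

/-- Doeblin's argument: each entry of `P x` puts weight at least `δ` on the common value `x r`. -/
theorem IsMarkov.spread_map_le [Finite ι] [Nonempty ι] (hP : IsMarkov P) {r : ι} {δ : ℝ}
    (hδ : ∀ i, δ ≤ P (Pi.single r 1) i) (x : ι → ℝ) : spread (P x) ≤ (1 - δ) * spread x := by
  obtain ⟨hinf, hsup⟩ := mem_Icc_iInf_iSup x
  have hneg : const ι (-⨆ i, x i) ≤ -x := fun i => neg_le_neg (hsup i)
  set m := ⨅ i, x i
  set M := ⨆ i, x i
  calc spread (P x) ≤ (M - δ * (M - x r)) - (m + δ * (x r - m)) := by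
        refine spread_le_of_mem_Icc ⟨hP.le_map_apply hδ hinf, fun i => ?_⟩
        have := hP.le_map_apply hδ hneg i
        simp only [map_neg, Pi.neg_apply, const_apply] at this ⊢
        linarith
    _ = (1 - δ) * spread x := by rw [spread]; ring

end Markov

section Semigroup

variable [Fintype ι] [DecidableEq ι] {T : (ι → ℝ) →L[ℝ] (ι → ℝ)}

theorem spread_linearFlow_nat_le [Nonempty ι] {r : ι} {δ : ℝ} (hT : IsMarkov (linearFlow T 1))
    (hδ : ∀ i, δ ≤ linearFlow T 1 (Pi.single r 1) i) (x : ι → ℝ) (k : ℕ) :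
    spread (linearFlow T k x) ≤ (1 - δ) ^ k * spread x := by
  have hδ_le_one : 0 ≤ 1 - δ := sub_nonneg.2 ((hδ r).trans (hT.map_single_le_one r r))
  induction k with
  | zero => simp [linearFlow_zero_right]
  | succ k ih =>
    calc spread (linearFlow T (k + 1 : ℕ) x)
        = spread (linearFlow T 1 (linearFlow T k x)) := by
          rw [Nat.cast_succ, add_comm, linearFlow_add_apply]
      _ ≤ (1 - δ) * spread (linearFlow T k x) := hT.spread_map_le hδ _
      _ ≤ (1 - δ) * ((1 - δ) ^ k * spread x) := mul_le_mul_of_nonneg_left ih hδ_le_one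
      _ = (1 - δ) ^ (k + 1) * spread x := by ring

theorem cauchySeq_linearFlow [Nonempty ι] {r : ι} {δ : ℝ}
    (hT : ∀ t, 0 ≤ t → IsMarkov (linearFlow T t)) (hδ_pos : 0 < δ)
    (hδ : ∀ i, δ ≤ linearFlow T 1 (Pi.single r 1) i) (x : ι → ℝ) :
    CauchySeq fun t => linearFlow T t x := by
  have hT₁ := hT 1 zero_le_one
  have hbound : Tendsto (fun k : ℕ => (1 - δ) ^ k * spread x) atTop (𝓝 0) := by
    simpa using (tendsto_pow_atTop_nhds_zero_of_lt_one
      (sub_nonneg.2 ((hδ r).trans (hT₁.map_single_le_one r r))) (by linarith)).mul_const (spread x)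
  refine Metric.cauchySeq_iff'.2 fun ε hε => ?_
  obtain ⟨k, hk⟩ := (hbound.eventually_lt_const hε).exists
  refine ⟨k, fun t ht => ?_⟩
  calc dist (linearFlow T t x) (linearFlow T k x)
      = dist (linearFlow T (t - k) (linearFlow T k x)) (linearFlow T k x) := by
        rw [← linearFlow_add_apply, sub_add_cancel]
    _ ≤ spread (linearFlow T k x) := (hT _ (sub_nonneg.2 ht)).dist_map_self_le_spread _
    _ ≤ (1 - δ) ^ k * spread x := spread_linearFlow_nat_le hT₁ hδ x k
    _ < ε := hk

theorem exists_tendsto_linearFlow_const {r : ι} (hT : ∀ t, 0 ≤ t → IsMarkov (linearFlow T t))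
    (hr : ∀ i, 0 < linearFlow T 1 (Pi.single r 1) i) (x : ι → ℝ) :
    ∃ a, Tendsto (fun t => linearFlow T t x) atTop (𝓝 (const ι a)) := by
  have : Nonempty ι := ⟨r⟩
  obtain ⟨i₀, hi₀⟩ := Finite.exists_min (linearFlow T 1 (Pi.single r 1))
  obtain ⟨w, hw⟩ := cauchySeq_tendsto_of_complete (cauchySeq_linearFlow hT (hr i₀) hi₀ x)
  have hspread := (hT 1 zero_le_one).spread_map_le hi₀ w
  rw [linearFlow_apply_of_map_eq_zero (map_eq_zero_of_tendsto_linearFlow hw)] at hspread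
  obtain ⟨a, rfl⟩ := exists_eq_const_of_spread_nonpos <|
    nonpos_of_mul_nonpos_right (a := linearFlow T 1 (Pi.single r 1) i₀) (by linarith) (hr i₀)
  exact ⟨a, hw⟩

theorem tendsto_linearFlow_of_tendsto_single {ν : ι → ℝ}
    (hν : ∀ j, Tendsto (fun t => linearFlow T t (Pi.single j 1)) atTop (𝓝 (const ι (ν j))))
    (x : ι → ℝ) : Tendsto (fun t => linearFlow T t x) atTop (𝓝 (const ι (ν ⬝ᵥ x))) := by
  have hlim : const ι (ν ⬝ᵥ x) = ∑ j, x j • const ι (ν j) := by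
    ext i
    simp [dotProduct, mul_comm]
  rw [hlim]
  refine (tendsto_finsetSum _ fun j _ => (hν j).const_smul (x j)).congr fun t => ?_
  conv_rhs => rw [pi_eq_sum_univ' x]
  simp only [map_sum, map_smul]

/-- The limit of the flow is a projection `x ↦ (ν ⬝ᵥ x) 1`, whose weights are the limits of the
basis vectors; they are conserved because the flow commutes with its generator. -/
theorem exists_invariant_distribution {r : ι} (hT : ∀ t, 0 ≤ t → IsMarkov (linearFlow T t))
    (hr : ∀ i, 0 < linearFlow T 1 (Pi.single r 1) i) :
    ∃ ν : ι → ℝ, 0 ≤ ν ∧ ∑ i, ν i = 1 ∧ ∀ x, ν ⬝ᵥ T x = 0 := by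
  have : Nonempty ι := ⟨r⟩
  choose ν hν using fun j => exists_tendsto_linearFlow_const hT hr (Pi.single j 1)
  have hlim := tendsto_linearFlow_of_tendsto_single hν
  refine ⟨ν, fun j => ?_, ?_, fun x => ?_⟩
  · refine ge_of_tendsto (tendsto_pi_nhds.1 (hν j) r) ?_
    filter_upwards [eventually_ge_atTop 0] with t ht
    exact (monotone_iff_map_nonneg _).1 (hT t ht).monotone _ (Pi.single_nonneg.2 zero_le_one) r
  · have hone : Tendsto (fun t => linearFlow T t 1) atTop (𝓝 1) :=
      tendsto_const_nhds.congr' <| (eventually_ge_atTop 0).mono fun t ht => (hT t ht).map_one.symm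
    simpa [dotProduct_one] using congrFun (tendsto_nhds_unique (hlim 1) hone) r
  · have hzero := (T.continuous.tendsto _).comp (hlim x)
    rw [map_eq_zero_of_tendsto_linearFlow (hlim x)] at hzero
    exact congrFun (tendsto_nhds_unique (hlim (T x))
      (hzero.congr fun t => (linearFlow_apply_map T t x).symm)) r

theorem tendsto_linearFlow_of_invariant {r : ι} (hT : ∀ t, 0 ≤ t → IsMarkov (linearFlow T t))
    (hr : ∀ i, 0 < linearFlow T 1 (Pi.single r 1) i) {ν : ι → ℝ} (hsum : ∑ i, ν i = 1)
    (hν : ∀ x, ν ⬝ᵥ T x = 0) (x : ι → ℝ) :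
    Tendsto (fun t => linearFlow T t x) atTop (𝓝 (const ι (ν ⬝ᵥ x))) := by
  obtain ⟨a, ha⟩ := exists_tendsto_linearFlow_const hT hr x
  let expectation : (ι → ℝ) →L[ℝ] ℝ := (dotProductBilin ℝ ℝ ν).toContinuousLinearMap
  have hconserved (t : ℝ) : expectation (linearFlow T t x) = ν ⬝ᵥ x :=
    map_linearFlow_apply_of_comp_eq_zero hν t x
  have hconst : expectation (const ι a) = a := by
    change ∑ i, ν i * a = a
    rw [← Finset.sum_mul, hsum, one_mul]
  have hlim := (expectation.continuous.tendsto _).comp ha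
  simp only [comp_def, hconserved, hconst] at hlim
  rwa [tendsto_nhds_unique tendsto_const_nhds hlim]

end Semigroup

end Consensus

section Laplacian

variable {n : ℕ} {κ : ℝ} {A : Matrix (Fin n) (Fin n) ℝ} {σ : Fin n → ℝ}

theorem laplacian_mulVec_apply (A : Matrix (Fin n) (Fin n) ℝ) (x : Fin n → ℝ) (i : Fin n) :
    (laplacian A *ᵥ x) i = ∑ j, (|A i j| * x i - A i j * x j) := by
  rw [laplacian, sub_mulVec, Pi.sub_apply, mulVec_diagonal, Finset.sum_sub_distrib,
    Finset.sum_mul]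
  rfl

theorem diagonal_mul_mul_diagonal_apply (A : Matrix (Fin n) (Fin n) ℝ) (σ : Fin n → ℝ)
    (i j : Fin n) : (diagonal σ * A * diagonal σ) i j = σ i * A i j * σ j := by
  rw [mul_diagonal, diagonal_mul]

/-- The generator `x ↦ -κ L x` of the system `ẋ = -κ L x`, as a continuous linear map. -/
noncomputable def generator (κ : ℝ) (A : Matrix (Fin n) (Fin n) ℝ) :
    (Fin n → ℝ) →L[ℝ] (Fin n → ℝ) :=
  -(κ • (laplacian A).mulVecLin.toContinuousLinearMap)

theorem generator_apply (κ : ℝ) (A : Matrix (Fin n) (Fin n) ℝ) (x : Fin n → ℝ) :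
    generator κ A x = -(κ • laplacian A *ᵥ x) :=
  rfl

theorem generator_apply_eq_zero_iff (hκ : κ ≠ 0) {x : Fin n → ℝ} :
    generator κ A x = 0 ↔ laplacian A *ᵥ x = 0 := by
  rw [generator_apply, neg_eq_zero, smul_eq_zero_iff_right hκ]

theorem vecMul_laplacian_eq_zero_iff (hκ : κ ≠ 0) {ν : Fin n → ℝ} :
    ν ᵥ* laplacian A = 0 ↔ ∀ x, ν ⬝ᵥ generator κ A x = 0 := by
  simp only [generator_apply, dotProduct_neg, dotProduct_smul, dotProduct_mulVec, neg_eq_zero,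
    smul_eq_zero_iff_right hκ, dotProduct_eq_zero_iff]

theorem isSolution_linearFlow (κ : ℝ) (A : Matrix (Fin n) (Fin n) ℝ) (x : Fin n → ℝ) :
    IsSolution κ A fun t => linearFlow (generator κ A) t x :=
  fun t _ => (hasDerivAt_linearFlow_apply (generator κ A) x t).hasDerivWithinAt

theorem IsSolution.eventuallyEq_linearFlow {x : ℝ → Fin n → ℝ} (hx : IsSolution κ A x) :
    x =ᶠ[atTop] fun t => linearFlow (generator κ A) t (x 0) :=
  (eventually_ge_atTop 0).mono fun _ ht =>
    eq_linearFlow_of_hasDerivWithinAt (T := generator κ A) hx ht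

end Laplacian

section Nonnegative

theorem exists_iterate_pos_of_reflTransGen {ι : Type*} {P : (ι → ℝ) → ι → ℝ} {R : ι → ι → Prop}
    (hP : ∀ x, 0 ≤ x → 0 ≤ P x) (hR : ∀ v w, R v w → ∀ x, 0 ≤ x → 0 < x v → 0 < P x w)
    {x : ι → ℝ} (hx : 0 ≤ x) {r v : ι} (hr : 0 < x r) (h : Relation.ReflTransGen R r v) :
    ∃ k : ℕ, 0 < P^[k] x v := by
  have hiterate (k : ℕ) : 0 ≤ P^[k] x := Iterate.rec (0 ≤ ·) hx hP k
  induction h with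
  | refl => exact ⟨0, hr⟩
  | @tail v w _ hvw ih =>
    obtain ⟨k, hk⟩ := ih
    exact ⟨k + 1, iterate_succ_apply' P k x ▸ hR v w hvw _ (hiterate k) hk⟩

variable {n : ℕ} {κ : ℝ} {A : Matrix (Fin n) (Fin n) ℝ}

/-- The generator, shifted by a multiple of the identity that makes it entrywise nonnegative when
`A` is. -/
noncomputable def shiftedGenerator (κ : ℝ) (A : Matrix (Fin n) (Fin n) ℝ) :
    (Fin n → ℝ) →L[ℝ] (Fin n → ℝ) :=
  generator κ A + (κ * ∑ i, ∑ j, |A i j|) • 1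

theorem shiftedGenerator_sub_smul_one (κ : ℝ) (A : Matrix (Fin n) (Fin n) ℝ) :
    shiftedGenerator κ A - (κ * ∑ i, ∑ j, |A i j|) • 1 = generator κ A :=
  add_sub_cancel_right _ _

theorem mul_le_shiftedGenerator_apply (hκ : 0 ≤ κ) (hA : ∀ i j, 0 ≤ A i j) {x : Fin n → ℝ}
    (hx : 0 ≤ x) (i j : Fin n) : κ * (A i j * x j) ≤ shiftedGenerator κ A x i := by
  have hrow : ∑ j, |A i j| ≤ ∑ i, ∑ j, |A i j| :=
    Finset.single_le_sum (f := fun i => ∑ j, |A i j|)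
      (fun i _ => Finset.sum_nonneg fun j _ => abs_nonneg _) (Finset.mem_univ i)
  have hentry : A i j * x j ≤ ∑ j, A i j * x j :=
    Finset.single_le_sum (f := fun j => A i j * x j)
      (fun j _ => mul_nonneg (hA i j) (hx j)) (Finset.mem_univ j)
  calc κ * (A i j * x j)
      ≤ κ * (∑ j, A i j * x j + ((∑ i, ∑ j, |A i j|) - ∑ j, |A i j|) * x i) :=
        mul_le_mul_of_nonneg_left
          (hentry.trans (le_add_of_nonneg_right (mul_nonneg (sub_nonneg.2 hrow) (hx i)))) hκ
    _ = shiftedGenerator κ A x i := by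
        simp only [shiftedGenerator, _root_.add_apply, Pi.add_apply, generator_apply, Pi.neg_apply,
          Pi.smul_apply, laplacian_mulVec_apply, _root_.smul_apply, one_apply_eq_self, smul_eq_mul,
          Finset.sum_sub_distrib, ← Finset.sum_mul]
        ring

theorem shiftedGenerator_apply_nonneg (hκ : 0 ≤ κ) (hA : ∀ i j, 0 ≤ A i j) {x : Fin n → ℝ}
    (hx : 0 ≤ x) : 0 ≤ shiftedGenerator κ A x := fun i =>
  (mul_nonneg hκ (mul_nonneg (hA i i) (hx i))).trans (mul_le_shiftedGenerator_apply hκ hA hx i i)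

theorem monotone_shiftedGenerator (hκ : 0 ≤ κ) (hA : ∀ i j, 0 ≤ A i j) :
    Monotone (shiftedGenerator κ A) :=
  (monotone_iff_map_nonneg _).2 fun _ hx => shiftedGenerator_apply_nonneg hκ hA hx

theorem laplacian_mulVec_one (hA : ∀ i j, 0 ≤ A i j) : laplacian A *ᵥ 1 = 0 := by
  ext i
  simp [laplacian_mulVec_apply, abs_of_nonneg (hA i _)]

theorem isMarkov_linearFlow_generator (hκ : 0 ≤ κ) (hA : ∀ i j, 0 ≤ A i j) {t : ℝ} (ht : 0 ≤ t) :
    IsMarkov (linearFlow (generator κ A) t) where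
  monotone := shiftedGenerator_sub_smul_one κ A ▸
    monotone_linearFlow_sub_smul_one (monotone_shiftedGenerator hκ hA) _ ht
  map_one := linearFlow_apply_of_map_eq_zero
    (by rw [generator_apply, laplacian_mulVec_one hA, smul_zero, neg_zero]) t

theorem linearFlow_generator_one_single_pos (hκ : 0 < κ) (hA : ∀ i j, 0 ≤ A i j) {r v : Fin n}
    (h : Relation.ReflTransGen (graphOf A).Adj r v) :
    0 < linearFlow (generator κ A) 1 (Pi.single r 1) v := by
  have hsingle : (0 : Fin n → ℝ) ≤ Pi.single r 1 := Pi.single_nonneg.2 zero_le_one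
  have hadj (j i : Fin n) (hji : (graphOf A).Adj j i) (x : Fin n → ℝ) (hx : 0 ≤ x)
      (hxj : 0 < x j) : 0 < shiftedGenerator κ A x i :=
    (mul_pos hκ (mul_pos ((hA i j).lt_of_ne' hji) hxj)).trans_le
      (mul_le_shiftedGenerator_apply hκ.le hA hx i j)
  obtain ⟨k, hk⟩ := exists_iterate_pos_of_reflTransGen
    (fun _ hx => shiftedGenerator_apply_nonneg hκ.le hA hx) hadj hsingle (by simp) h
  obtain ⟨ε, hε, hle⟩ := exists_pos_smul_iterate_le_linearFlow_one
    (monotone_shiftedGenerator hκ.le hA) (κ * ∑ i, ∑ j, |A i j|) hsingle k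
  rw [shiftedGenerator_sub_smul_one] at hle
  exact (mul_pos hε hk).trans_le (hle v)

theorem HasSpanningTree.exists_root {V : Type*} {G : Digraph V} (h : HasSpanningTree G) :
    ∃ r, ∀ v, Relation.ReflTransGen G.Adj r v := by
  obtain ⟨r, hr⟩ := h
  refine ⟨r, fun v => ?_⟩
  obtain rfl | hv := eq_or_ne v r
  exacts [.refl, hr v hv]

end Nonnegative

section Switching

variable {n : ℕ} {κ : ℝ} {A : Matrix (Fin n) (Fin n) ℝ} {σ : Fin n → ℝ}

theorem isSignSwitching_iff_laplacian_mulVec_eq_zero (hσ : ∀ i, σ i = 1 ∨ σ i = -1) :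
    IsSignSwitching A σ ↔ laplacian A *ᵥ σ = 0 := by
  have hsq (i : Fin n) : σ i * σ i = 1 := mul_self_eq_one_iff.2 (hσ i)
  have habs (i : Fin n) : |σ i| = 1 := abs_eq zero_le_one |>.2 (hσ i)
  have hrow (i : Fin n) : σ i * (laplacian A *ᵥ σ) i =
      ∑ j, (|σ i * A i j * σ j| - σ i * A i j * σ j) := by
    rw [laplacian_mulVec_apply, Finset.mul_sum]
    refine Finset.sum_congr rfl fun j _ => ?_
    rw [abs_mul, abs_mul, habs, habs]
    linear_combination |A i j| * hsq i
  have hrow_iff (i : Fin n) : (laplacian A *ᵥ σ) i = 0 ↔ ∀ j, 0 ≤ σ i * A i j * σ j := by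
    rw [← mul_eq_zero_iff_left (left_ne_zero_of_mul_eq_one (hsq i)), hrow,
      Finset.sum_eq_zero_iff_of_nonneg fun j _ => sub_nonneg.2 (le_abs_self _)]
    simp only [Finset.mem_univ, true_imp_iff, sub_eq_zero, abs_eq_self]
  simp only [IsSignSwitching, hσ, diagonal_mul_mul_diagonal_apply, funext_iff, hrow_iff,
    Pi.zero_apply, implies_true, true_and]

theorem IsSignSwitching.laplacian_mulVec_eq_zero (h : IsSignSwitching A σ) :
    laplacian A *ᵥ σ = 0 :=
  (isSignSwitching_iff_laplacian_mulVec_eq_zero h.1).1 h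

theorem IsSignSwitching.mul_self (h : IsSignSwitching A σ) (i : Fin n) : σ i * σ i = 1 :=
  mul_self_eq_one_iff.2 (h.1 i)

theorem IsSignSwitching.abs_eq_one (h : IsSignSwitching A σ) (i : Fin n) : |σ i| = 1 :=
  (abs_eq zero_le_one).2 (h.1 i)

theorem IsSignSwitching.involutive (h : IsSignSwitching A σ) : Involutive (diagonal σ *ᵥ ·) :=
  fun x => by
    ext i
    simp [mulVec_diagonal, ← mul_assoc, h.mul_self]

theorem IsSignSwitching.graphOf_eq (h : IsSignSwitching A σ) :
    graphOf (diagonal σ * A * diagonal σ) = graphOf A := by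
  have hσ (i : Fin n) : σ i ≠ 0 := left_ne_zero_of_mul_eq_one (h.mul_self i)
  ext j i
  simp [graphOf, hσ]

theorem IsSignSwitching.generator_apply (h : IsSignSwitching A σ) (κ : ℝ) (x : Fin n → ℝ) :
    diagonal σ *ᵥ generator κ A x =
      generator κ (diagonal σ * A * diagonal σ) (diagonal σ *ᵥ x) := by
  simp only [SignedConsensus.generator_apply, mulVec_neg, mulVec_smul]
  congr 2
  ext i
  simp only [mulVec_diagonal, laplacian_mulVec_apply, diagonal_mul_mul_diagonal_apply, abs_mul,
    h.abs_eq_one, Finset.mul_sum]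
  refine Finset.sum_congr rfl fun j _ => ?_
  linear_combination σ i * A i j * x j * h.mul_self j

theorem IsSignSwitching.linearFlow_apply (h : IsSignSwitching A σ) (κ t : ℝ) (x : Fin n → ℝ) :
    diagonal σ *ᵥ linearFlow (generator κ A) t x =
      linearFlow (generator κ (diagonal σ * A * diagonal σ)) t (diagonal σ *ᵥ x) :=
  semiconj_linearFlow (S := (diagonal σ).mulVecLin.toContinuousLinearMap)
    (h.generator_apply κ) t x

theorem diagonal_mulVec_dotProduct (σ ν x : Fin n → ℝ) :
    (diagonal σ *ᵥ ν) ⬝ᵥ x = ν ⬝ᵥ (diagonal σ *ᵥ x) := by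
  simp only [dotProduct, mulVec_diagonal, mul_assoc, mul_left_comm]

theorem IsSignSwitching.vecMul_laplacian_eq_zero_iff (h : IsSignSwitching A σ) (hκ : κ ≠ 0)
    (ν : Fin n → ℝ) : (diagonal σ *ᵥ ν) ᵥ* laplacian A = 0 ↔
      ∀ x, ν ⬝ᵥ generator κ (diagonal σ * A * diagonal σ) x = 0 := by
  rw [SignedConsensus.vecMul_laplacian_eq_zero_iff hκ]
  refine Iff.trans ?_ h.involutive.surjective.forall.symm
  simp only [diagonal_mulVec_dotProduct, h.generator_apply]

theorem IsSignSwitching.sum_abs_diagonal_mulVec (h : IsSignSwitching A σ) {ν : Fin n → ℝ}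
    (hν : 0 ≤ ν) : ∑ i, |(diagonal σ *ᵥ ν) i| = ∑ i, ν i := by
  simp [mulVec_diagonal, abs_mul, h.abs_eq_one, abs_of_nonneg (hν _)]

theorem IsSignSwitching.exists_isNormalizedLeftNull (h : IsSignSwitching A σ)
    (htree : HasSpanningTree (graphOf A)) : ∃ η, IsNormalizedLeftNull A σ η := by
  obtain ⟨r, hr⟩ := (h.graphOf_eq ▸ htree).exists_root
  obtain ⟨ν, hν, hsum, hnull⟩ := exists_invariant_distribution
    (fun _ => isMarkov_linearFlow_generator zero_le_one h.2)
    (fun v => linearFlow_generator_one_single_pos one_pos h.2 (hr v))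
  exact ⟨diagonal σ *ᵥ ν, (h.vecMul_laplacian_eq_zero_iff one_ne_zero ν).2 hnull,
    (h.sum_abs_diagonal_mulVec hν).trans hsum, ν, hν, rfl⟩

theorem IsSignSwitching.tendsto (h : IsSignSwitching A σ) (hκ : 0 < κ)
    (htree : HasSpanningTree (graphOf A)) {η : Fin n → ℝ} (hη : IsNormalizedLeftNull A σ η)
    {x : ℝ → Fin n → ℝ} (hx : IsSolution κ A x) :
    Tendsto x atTop (𝓝 ((η ⬝ᵥ x 0) • σ)) := by
  obtain ⟨hnull, hsum, ν, hν, rfl⟩ := hη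
  obtain ⟨r, hr⟩ := (h.graphOf_eq ▸ htree).exists_root
  have hlim := tendsto_linearFlow_of_invariant
    (fun _ => isMarkov_linearFlow_generator hκ.le h.2)
    (fun v => linearFlow_generator_one_single_pos hκ h.2 (hr v))
    ((h.sum_abs_diagonal_mulVec hν).symm.trans hsum)
    ((h.vecMul_laplacian_eq_zero_iff hκ.ne' ν).1 hnull) (diagonal σ *ᵥ x 0)
  have hswitch : Continuous (diagonal σ *ᵥ · : (Fin n → ℝ) → Fin n → ℝ) := by fun_prop
  have hconst (c : ℝ) : diagonal σ *ᵥ const (Fin n) c = c • σ := by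
    ext i
    simp [mulVec_diagonal, mul_comm]
  rw [diagonal_mulVec_dotProduct, ← hconst]
  refine ((hswitch.tendsto _).comp hlim).congr' ?_
  filter_upwards [hx.eventuallyEq_linearFlow] with t ht
  rw [ht, Function.comp_apply, ← h.linearFlow_apply]
  exact h.involutive _

end Switching

section EssentiallyNonnegative

variable {n : ℕ} {A : Matrix (Fin n) (Fin n) ℝ} {σ : Fin n → ℝ}

/-- The sign of a complex number with respect to the upper half-plane, the real axis being split at
the origin. It replaces unit complex switchings by real ones, being odd away from `0`, where its
value is the junk value `-1`. -/
noncomputable def halfPlaneSign (z : ℂ) : ℝ :=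
  open Classical in if 0 < z.im ∨ z.im = 0 ∧ 0 < z.re then 1 else -1

theorem halfPlaneSign_eq_one_or_eq_neg_one (z : ℂ) :
    halfPlaneSign z = 1 ∨ halfPlaneSign z = -1 := by
  unfold halfPlaneSign
  split_ifs <;> simp

theorem halfPlaneSign_neg {z : ℂ} (hz : z ≠ 0) : halfPlaneSign (-z) = -halfPlaneSign z := by
  have hz' : ¬(z.re = 0 ∧ z.im = 0) := fun h => hz (Complex.ext h.1 h.2)
  simp only [halfPlaneSign, Complex.neg_im, Complex.neg_re]
  grind

theorem halfPlaneSign_ofReal_mul_of_pos {a : ℝ} (ha : 0 < a) (z : ℂ) :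
    halfPlaneSign (a * z) = halfPlaneSign z := by
  simp [halfPlaneSign, ha, ha.ne']

theorem halfPlaneSign_ofReal_mul {a : ℝ} (ha : a ≠ 0) {z : ℂ} (hz : z ≠ 0) :
    halfPlaneSign (a * z) = SignType.sign a * halfPlaneSign z := by
  obtain ha | ha := ha.lt_or_gt
  · rw [← neg_neg (a : ℂ), neg_mul_comm, ← Complex.ofReal_neg,
      halfPlaneSign_ofReal_mul_of_pos (neg_pos.2 ha), halfPlaneSign_neg hz]
    simp [ha]
  · simp [halfPlaneSign_ofReal_mul_of_pos ha, ha]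

theorem switchingEquivalent_iff {A₁ A₂ : Matrix (Fin n) (Fin n) ℂ} :
    SwitchingEquivalent A₁ A₂ ↔ ∃ ζ : Fin n → Circle, ∀ i j, ζ i * A₂ i j = A₁ i j * ζ j := by
  refine exists_congr fun ζ => ?_
  have hunit : IsUnit (diagCircle ζ).det := by
    simp [diagCircle, det_diagonal, Finset.prod_ne_zero_iff]
  have hmul : A₂ = (diagCircle ζ)⁻¹ * A₁ * diagCircle ζ ↔
      diagCircle ζ * A₂ = A₁ * diagCircle ζ := by
    rw [mul_assoc]
    exact ⟨fun h => h ▸ mul_nonsing_inv_cancel_left _ _ hunit,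
      fun h => h ▸ (nonsing_inv_mul_cancel_left _ _ hunit).symm⟩
  rw [hmul, ← Matrix.ext_iff]
  simp only [diagCircle, diagonal_mul, mul_diagonal]

theorem EssentiallyNonnegative.exists_isSignSwitching
    (h : EssentiallyNonnegative (A.map Complex.ofReal)) : ∃ σ, IsSignSwitching A σ := by
  obtain ⟨B, hB, hBA⟩ := h
  obtain ⟨ζ, hζ⟩ := switchingEquivalent_iff.1 hBA
  simp only [map_apply] at hζ
  refine ⟨fun i => halfPlaneSign (ζ i), fun i => halfPlaneSign_eq_one_or_eq_neg_one _,
    fun i j => ?_⟩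
  rw [diagonal_mul_mul_diagonal_apply]
  obtain hA | hA := eq_or_ne (A i j) 0
  · simp [hA]
  have hBpos : 0 < B i j := (hB i j).lt_of_ne' fun hBij => by
    simpa [hBij, hA] using hζ i j
  have hsign : halfPlaneSign (ζ i) = SignType.sign (A i j) * halfPlaneSign (ζ j) := by
    rw [← halfPlaneSign_ofReal_mul hA (Circle.coe_ne_zero _), ← hζ, mul_comm,
      halfPlaneSign_ofReal_mul_of_pos hBpos]
  calc 0 ≤ |A i j| * (halfPlaneSign (ζ j) * halfPlaneSign (ζ j)) :=
        mul_nonneg (abs_nonneg _) (mul_self_nonneg _)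
    _ = halfPlaneSign (ζ i) * A i j * halfPlaneSign (ζ j) := by
        rw [hsign, ← sign_mul_self]
        ring

theorem IsSignSwitching.essentiallyNonnegative (h : IsSignSwitching A σ) :
    EssentiallyNonnegative (A.map Complex.ofReal) := by
  have hcircle (i : Fin n) : ∃ z : Circle, (z : ℂ) = σ i :=
    ⟨⟨σ i, by simp [Submonoid.unitSphere, h.abs_eq_one]⟩, rfl⟩
  choose ζ hζ using hcircle
  refine ⟨diagonal σ * A * diagonal σ, h.2, switchingEquivalent_iff.2 ⟨ζ, fun i j => ?_⟩⟩
  have hij : σ i * (σ i * A i j * σ j) = A i j * σ j := by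
    linear_combination A i j * σ j * h.mul_self i
  rw [hζ, hζ, map_apply, map_apply, diagonal_mul_mul_diagonal_apply]
  exact_mod_cast hij

end EssentiallyNonnegative

section BipartiteConsensus

variable {n : ℕ} {κ : ℝ} {A : Matrix (Fin n) (Fin n) ℝ} {σ : Fin n → ℝ} {x : ℝ → Fin n → ℝ}

theorem ConvergesUpToSign.exists_tendsto {a : ℝ} (h : ConvergesUpToSign x a) :
    ∃ σ : Fin n → ℝ, (∀ i, σ i = 1 ∨ σ i = -1) ∧ Tendsto x atTop (𝓝 (a • σ)) := by
  have hlim (i : Fin n) : ∃ s : ℝ, (s = 1 ∨ s = -1) ∧ Tendsto (x · i) atTop (𝓝 (a * s)) := by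
    obtain hi | hi := h i
    exacts [⟨1, .inl rfl, by simpa using hi⟩, ⟨-1, .inr rfl, by simpa using hi⟩]
  choose σ hσ hlim using hlim
  exact ⟨σ, hσ, tendsto_pi_nhds.2 hlim⟩

theorem convergesUpToSign_of_tendsto_smul (hσ : ∀ i, σ i = 1 ∨ σ i = -1) {c : ℝ}
    (hx : Tendsto x atTop (𝓝 (c • σ))) : ConvergesUpToSign x |c| := by
  intro i
  have hi : Tendsto (x · i) atTop (𝓝 (c * σ i)) := tendsto_pi_nhds.1 hx i
  have hc : |c * σ i| = |c| := by
    rw [abs_mul, (abs_eq zero_le_one).2 (hσ i), mul_one]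
  obtain h | h := (abs_eq (abs_nonneg c)).1 hc
  exacts [.inl (h ▸ hi), .inr (h ▸ hi)]

theorem ConvergesUpToSign.abs_eq {a c : ℝ} (h : ConvergesUpToSign x a) (ha : 0 ≤ a) {i : Fin n}
    (hc : Tendsto (x · i) atTop (𝓝 c)) : |c| = a :=
  (_root_.abs_eq ha).2 <| (h i).imp (tendsto_nhds_unique hc) (tendsto_nhds_unique hc)

theorem AchievesBipartiteConsensus.exists_isSignSwitching (hκ : κ ≠ 0)
    (h : AchievesBipartiteConsensus κ A) : ∃ σ, IsSignSwitching A σ := by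
  obtain ⟨-, x, hx, a, ha, hconv⟩ := h
  obtain ⟨σ, hσ, hlim⟩ := hconv.exists_tendsto
  have hequilibrium : generator κ A (a • σ) = 0 :=
    map_eq_zero_of_tendsto_linearFlow (hlim.congr' hx.eventuallyEq_linearFlow)
  rw [map_smul, smul_eq_zero_iff_right ha.ne', generator_apply_eq_zero_iff hκ] at hequilibrium
  exact ⟨σ, (isSignSwitching_iff_laplacian_mulVec_eq_zero hσ).2 hequilibrium⟩

theorem eqOn_linearFlow_generator {S : Set (Fin n)} (hS : ∀ i ∈ S, ∀ j, A i j ≠ 0 → j ∈ S)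
    {z w : Fin n → ℝ} (hzw : Set.EqOn z w S) (t : ℝ) :
    Set.EqOn (linearFlow (generator κ A) t z) (linearFlow (generator κ A) t w) S := by
  let W : Submodule ℝ (Fin n → ℝ) := Submodule.pi S fun _ => ⊥
  have hinvariant (y : Fin n → ℝ) (hy : ∀ i ∈ S, y i = 0) : ∀ i ∈ S, generator κ A y i = 0 := by
    intro i hi
    have hterm (j : Fin n) : A i j * y j = 0 :=
      mul_eq_zero.2 <| or_iff_not_imp_left.2 fun hij => hy j (hS i hi j hij)
    simp [generator_apply, laplacian_mulVec_apply, hterm, hy i hi]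
  have hmem : linearFlow (generator κ A) t (z - w) ∈ W :=
    linearFlow_apply_mem W.closed_of_finiteDimensional hinvariant
      (fun i hi => sub_eq_zero.2 (hzw hi)) t
  rw [map_sub] at hmem
  exact fun i hi => sub_eq_zero.1 (hmem i hi)

theorem hasSpanningTree_of_common_ancestors {V : Type*} [Finite V] [Nonempty V] {G : Digraph V}
    (h : ∀ u v, ∃ w, Relation.ReflTransGen G.Adj w u ∧ Relation.ReflTransGen G.Adj w v) :
    HasSpanningTree G := by
  have hdir : Directed (fun u v => Relation.ReflTransGen G.Adj v u) (id : V → V) := h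
  have : IsTrans V (fun u v => Relation.ReflTransGen G.Adj v u) := ⟨fun _ _ _ h₁ h₂ => h₂.trans h₁⟩
  obtain ⟨r, hr⟩ := hdir.finite_le id
  exact ⟨r, fun v _ => hr v⟩

/-- Vertices `u` and `v` without a common ancestor evolve independently: the state equal to a
switching on the ancestors of `u` and to `0` elsewhere stays unimodular at `u` and `0` at `v`. -/
theorem AchievesBipartiteConsensus.hasSpanningTree (hn : 0 < n) (hκ : κ ≠ 0)
    (h : AchievesBipartiteConsensus κ A) : HasSpanningTree (graphOf A) := by
  have : Nonempty (Fin n) := ⟨⟨0, hn⟩⟩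
  obtain ⟨σ, hσ⟩ := h.exists_isSignSwitching hκ
  refine hasSpanningTree_of_common_ancestors fun u v => ?_
  by_contra! hdisj
  let ancestors (w : Fin n) : Set (Fin n) := {i | Relation.ReflTransGen (graphOf A).Adj i w}
  have hclosed (w i : Fin n) (hi : i ∈ ancestors w) (j : Fin n) (hij : A i j ≠ 0) :
      j ∈ ancestors w := .head hij hi
  let z := (ancestors u).indicator σ
  have hzu : Set.EqOn z σ (ancestors u) := Set.eqOn_indicator
  have hzv : Set.EqOn z 0 (ancestors v) := fun i hi =>
    Set.indicator_of_notMem (s := ancestors u) (fun hi' => hdisj i hi' hi) σ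
  have hflow_u (t : ℝ) : linearFlow (generator κ A) t z u = σ u := by
    have hσ_fixed := linearFlow_apply_of_map_eq_zero
      ((generator_apply_eq_zero_iff hκ).2 hσ.laplacian_mulVec_eq_zero) t
    rw [eqOn_linearFlow_generator (hclosed u) hzu t .refl, hσ_fixed]
  have hflow_v (t : ℝ) : linearFlow (generator κ A) t z v = 0 := by
    rw [eqOn_linearFlow_generator (hclosed v) hzv t .refl, map_zero, Pi.zero_apply]
  obtain ⟨a, ha, hconv⟩ := h.1 _ (isSolution_linearFlow κ A z)
  have hau : |σ u| = a :=
    hconv.abs_eq ha (i := u) (by simp only [hflow_u, tendsto_const_nhds])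
  have hav : |0| = a :=
    hconv.abs_eq ha (i := v) (by simp only [hflow_v, tendsto_const_nhds])
  rw [hσ.abs_eq_one, ← hav, abs_zero] at hau
  exact one_ne_zero hau

theorem IsSignSwitching.achievesBipartiteConsensus (h : IsSignSwitching A σ) (hκ : 0 < κ)
    (htree : HasSpanningTree (graphOf A)) : AchievesBipartiteConsensus κ A := by
  have hconst : IsSolution κ A fun _ => σ := fun t _ => by
    simpa [h.laplacian_mulVec_eq_zero] using hasDerivWithinAt_const t (Set.Ici 0) σ
  obtain ⟨η, hη⟩ := h.exists_isNormalizedLeftNull htree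
  refine ⟨fun x hx => ⟨_, abs_nonneg _,
    convergesUpToSign_of_tendsto_smul h.1 (h.tendsto hκ htree hη hx)⟩, _, hconst, |1|, by simp, ?_⟩
  exact convergesUpToSign_of_tendsto_smul h.1 (by simp only [one_smul, tendsto_const_nhds])

end BipartiteConsensus

end SignedConsensus

theorem mainTheorem7_general {n : ℕ} (hn : 0 < n) (A : Matrix (Fin n) (Fin n) ℝ)
    (κ : ℝ) (hκ : 0 < κ) :
    (SignedConsensus.AchievesBipartiteConsensus κ A ↔
      SignedConsensus.EssentiallyNonnegative (A.map Complex.ofReal) ∧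
        SignedConsensus.HasSpanningTree (SignedConsensus.graphOf A)) ∧
    (SignedConsensus.EssentiallyNonnegative (A.map Complex.ofReal) ∧
        SignedConsensus.HasSpanningTree (SignedConsensus.graphOf A) →
      (∃ σ : Fin n → ℝ, SignedConsensus.IsSignSwitching A σ) ∧
      ∀ σ : Fin n → ℝ, SignedConsensus.IsSignSwitching A σ →
        (∃ η : Fin n → ℝ, SignedConsensus.IsNormalizedLeftNull A σ η) ∧
        ∀ η : Fin n → ℝ, SignedConsensus.IsNormalizedLeftNull A σ η →
          ∀ x : ℝ → Fin n → ℝ, SignedConsensus.IsSolution κ A x →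
            Filter.Tendsto x Filter.atTop (nhds ((η ⬝ᵥ x 0) • σ))) := by
  refine ⟨⟨fun h => ?_, fun ⟨hess, htree⟩ => ?_⟩, fun ⟨hess, htree⟩ => ?_⟩
  · obtain ⟨σ, hσ⟩ := h.exists_isSignSwitching hκ.ne'
    exact ⟨hσ.essentiallyNonnegative, h.hasSpanningTree hn hκ.ne'⟩
  · obtain ⟨σ, hσ⟩ := hess.exists_isSignSwitching
    exact hσ.achievesBipartiteConsensus hκ htree
  · exact ⟨hess.exists_isSignSwitching, fun σ hσ =>
      ⟨hσ.exists_isNormalizedLeftNull htree, fun η hη x hx => hσ.tendsto hκ htree hη hx⟩⟩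

theorem mainTheorem7 {n : ℕ} (hn : 0 < n) (A : Matrix (Fin n) (Fin n) ℝ)
    (hA : ∀ i, A i i = 0) (κ : ℝ) (hκ : 0 < κ) :
    (SignedConsensus.AchievesBipartiteConsensus κ A ↔
      SignedConsensus.EssentiallyNonnegative (A.map Complex.ofReal) ∧
        SignedConsensus.HasSpanningTree (SignedConsensus.graphOf A)) ∧
    (SignedConsensus.EssentiallyNonnegative (A.map Complex.ofReal) ∧
        SignedConsensus.HasSpanningTree (SignedConsensus.graphOf A) →
      (∃ σ : Fin n → ℝ, SignedConsensus.IsSignSwitching A σ) ∧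
      ∀ σ : Fin n → ℝ, SignedConsensus.IsSignSwitching A σ →
        (∃ η : Fin n → ℝ, SignedConsensus.IsNormalizedLeftNull A σ η) ∧
        ∀ η : Fin n → ℝ, SignedConsensus.IsNormalizedLeftNull A σ η →
          ∀ x : ℝ → Fin n → ℝ, SignedConsensus.IsSolution κ A x →
            Filter.Tendsto x Filter.atTop (nhds ((η ⬝ᵥ x 0) • σ))) :=
  mainTheorem7_general hn A κ hκ
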